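/- **Corollary 4.6.** For complex Banach spaces $X,Y$ let the Kadets distance be $$d_K(X,Y)=\inf_{Z,U,V}\ d_Z\bigl(U(B_X),V(B_Y)\bigr),$$ where $B_X,B_Y$ are the closed unit balls, $d_Z$ is the Hausdorff distance of subsets of $Z$, and the infimum is over all complex Banach spaces $Z$ and all linear isometric embeddings $U:X\to Z$, $V:Y\to Z$. Let $(X_0,X_1)$ be a complex Banach couple, i.e. two complex Banach spaces embedded linearly and continuously in a common Hausdorff topological vector space, and give $X_0+X_1$ the norm $\|x\|=\inf\{\|x_0\|_{X_0}+\|x_1\|_{X_1}: x=x_0+x_1\}$. Let $\mathcal F$ be the set of all functions $f:\{0\le\operatorname{Re}z\le1\}\to X_0+X_1$ that are continuous and bounded, analytic on $\{0<\operatorname{Re}z<1\}$, and such that for $j=0,1$ the function $t\mapsto f(j+it)$ is a continuous function from $\mathbb R$ to $X_j$ that tends to $0$ in $X_j$ as $|t|\to\infty$. Put $$\|f\|_{\mathcal F}=\max\Bigl\{\sup_{t\in\mathbb R}\|f(it)\|_{X_0},\ \sup_{t\in\mathbb R}\|f(1+it)\|_{X_1}\Bigr\}.$$ For $0<\theta<1$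 let $X_\theta=[X_0,X_1]_\theta=\{f(\theta):f\in\mathcal F\}$, with the norm $\|x\|_\theta=\inf\{\|f\|_{\mathcal F}:f\in\mathcal F,\ f(\theta)=x\}$. Then for all $0<\theta<\varphi<1$, $$d_K(X_\theta,X_\varphi)\le 2\,\frac{\sin(\pi(\varphi-\theta)/2)}{\sin(\pi(\varphi+\theta)/2)}.$$ Moreover the map $\theta\mapsto X_\theta$ is continuous on $(0,1)$ for $d_K$: for every $\theta\in(0,1)$, $d_K(X_\theta,X_\varphi)\to0$ as $\varphi\to\theta$, $\varphi\in(0,1)$. -/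

import Mathlib

open Set Filter Topology Complex
open scoped ZeroAtInfty

universe u v w

/-! ### The Kadets distance -/

/-- The Kadets distance between two complex normed spaces: the infimum, over all complex Banach
spaces `Z` and all linear isometric embeddings `U : X → Z`, `V : Y → Z`, of the Hausdorff distance
between the images of the closed unit balls. (Replacing `Z` by the closed span of the two images,
one sees that the universe `max u v` is large enough.) -/
noncomputable def kadetsDist (X : Type u) (Y : Type v) [NormedAddCommGroup X] [NormedSpace ℂ X]
    [NormedAddCommGroup Y] [NormedSpace ℂ Y] : ℝ :=
  sInf {r : ℝ | ∃ (Z : Type (max u v)) (_ : NormedAddCommGroup Z) (_ : NormedSpace ℂ Z)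
    (_ : CompleteSpace Z) (U : X →ₗᵢ[ℂ] Z) (V : Y →ₗᵢ[ℂ] Z),
    r = Metric.hausdorffDist (U '' Metric.closedBall 0 1) (V '' Metric.closedBall 0 1)}

/-- The infimum defining the Kadets distance is over a nonempty set. -/
theorem kadetsDist_set_nonempty (X : Type u) (Y : Type v) [NormedAddCommGroup X] [NormedSpace ℂ X]
    [NormedAddCommGroup Y] [NormedSpace ℂ Y] :
    {r : ℝ | ∃ (Z : Type (max u v)) (_ : NormedAddCommGroup Z) (_ : NormedSpace ℂ Z)
    (_ : CompleteSpace Z) (U : X →ₗᵢ[ℂ] Z) (V : Y →ₗᵢ[ℂ] Z),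
    r = Metric.hausdorffDist (U '' Metric.closedBall 0 1) (V '' Metric.closedBall 0 1)}.Nonempty :=
  ⟨_, UniformSpace.Completion (X × Y), inferInstance, inferInstance, inferInstance,
    (UniformSpace.Completion.toComplₗᵢ (𝕜 := ℂ) (E := X × Y)).comp
      ⟨LinearMap.inl ℂ X Y, fun x => by simp [Prod.norm_def]⟩,
    (UniformSpace.Completion.toComplₗᵢ (𝕜 := ℂ) (E := X × Y)).comp
      ⟨LinearMap.inr ℂ X Y, fun x => by simp [Prod.norm_def]⟩, rfl⟩

/-! ### Banach couples -/

/-- A complex Banach couple: two complex Banach spaces `X₀`, `X₁`, continuously and linearly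
embedded in a common Hausdorff topological vector space `V`. -/
structure BanachCouple (X₀ : Type u) (X₁ : Type v) (V : Type w)
    [NormedAddCommGroup X₀] [NormedSpace ℂ X₀] [CompleteSpace X₀]
    [NormedAddCommGroup X₁] [NormedSpace ℂ X₁] [CompleteSpace X₁]
    [AddCommGroup V] [Module ℂ V] [TopologicalSpace V] [IsTopologicalAddGroup V]
    [ContinuousSMul ℂ V] [T2Space V] where
  /-- the embedding of `X₀` -/
  ι₀ : X₀ →L[ℂ] V
  /-- the embedding of `X₁` -/
  ι₁ : X₁ →L[ℂ] V
  ι₀_injective : Function.Injective ι₀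
  ι₁_injective : Function.Injective ι₁

namespace BanachCouple

variable {X₀ : Type u} {X₁ : Type v} {V : Type w}
  [NormedAddCommGroup X₀] [NormedSpace ℂ X₀] [CompleteSpace X₀]
  [NormedAddCommGroup X₁] [NormedSpace ℂ X₁] [CompleteSpace X₁]
  [AddCommGroup V] [Module ℂ V] [TopologicalSpace V] [IsTopologicalAddGroup V]
  [ContinuousSMul ℂ V] [T2Space V] (c : BanachCouple X₀ X₁ V)

/-- The map `(x₀, x₁) ↦ x₀ + x₁` from the `ℓ¹`-sum of `X₀` and `X₁` to the ambient space. -/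
def addMap : WithLp 1 (X₀ × X₁) →ₗ[ℂ] V where
  toFun p := c.ι₀ p.fst + c.ι₁ p.snd
  map_add' p q := by simp only [WithLp.add_fst, WithLp.add_snd, map_add]; abel
  map_smul' a p := by simp

instance isClosed_ker_addMap : IsClosed (LinearMap.ker c.addMap : Set (WithLp 1 (X₀ × X₁))) := by
  have h : Continuous c.addMap := by
    change Continuous fun p : WithLp 1 (X₀ × X₁) => c.ι₀ p.fst + c.ι₁ p.snd
    fun_prop
  exact isClosed_singleton.preimage h

/-- The Banach space `X₀ + X₁`, with the norm `inf {‖x₀‖ + ‖x₁‖ : x = x₀ + x₁}`. It is realized as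
the quotient of the `ℓ¹`-sum by the kernel of `(x₀, x₁) ↦ x₀ + x₁`; `toAmbient` identifies it with
the subspace `X₀ + X₁` of `V`, and `sum_norm_eq` is the formula for the norm. -/
abbrev Sum : Type (max u v) := WithLp 1 (X₀ × X₁) ⧸ LinearMap.ker c.addMap

/-- The inclusion of `X₀ + X₁` in the ambient space `V`. -/
def toAmbient : c.Sum →ₗ[ℂ] V := (LinearMap.ker c.addMap).liftQ c.addMap le_rfl

theorem toAmbient_injective : Function.Injective c.toAmbient :=
  LinearMap.ker_eq_bot.1 (Submodule.ker_liftQ_eq_bot' _ _ rfl)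

theorem range_toAmbient :
    Set.range c.toAmbient = {x | ∃ x₀ x₁, c.ι₀ x₀ + c.ι₁ x₁ = x} := by
  ext x
  constructor
  · rintro ⟨y, rfl⟩
    obtain ⟨p, rfl⟩ := Submodule.Quotient.mk_surjective _ y
    exact ⟨p.fst, p.snd, rfl⟩
  · rintro ⟨x₀, x₁, rfl⟩
    exact ⟨Submodule.Quotient.mk (WithLp.toLp 1 (x₀, x₁)), rfl⟩

theorem sum_norm_eq (x : c.Sum) :
    ‖x‖ = sInf {r : ℝ | ∃ x₀ x₁, c.ι₀ x₀ + c.ι₁ x₁ = c.toAmbient x ∧ r = ‖x₀‖ + ‖x₁‖} := by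
  have key : ∀ p : WithLp 1 (X₀ × X₁), (Submodule.Quotient.mk p : c.Sum) = x ↔
      c.ι₀ p.fst + c.ι₁ p.snd = c.toAmbient x := fun p =>
    (c.toAmbient_injective.eq_iff (a := Submodule.Quotient.mk p) (b := x)).symm
  have hne : {r : ℝ | ∃ x₀ x₁, c.ι₀ x₀ + c.ι₁ x₁ = c.toAmbient x ∧ r = ‖x₀‖ + ‖x₁‖}.Nonempty := by
    obtain ⟨p, hp⟩ := Submodule.Quotient.mk_surjective _ x
    exact ⟨_, p.fst, p.snd, (key p).1 hp, rfl⟩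
  apply le_antisymm
  · refine le_csInf hne ?_
    rintro r ⟨x₀, x₁, h, rfl⟩
    rw [← (key (WithLp.toLp 1 (x₀, x₁))).2 h]
    exact (Submodule.Quotient.norm_mk_le _ _).trans (WithLp.prod_norm_eq_of_L1 _).le
  · refine le_of_forall_pos_le_add fun ε hε => ?_
    obtain ⟨p, hp, hlt⟩ := Submodule.Quotient.norm_mk_lt x hε
    rw [WithLp.prod_norm_eq_of_L1] at hlt
    refine le_trans (csInf_le ?_ ?_) hlt.le
    · refine ⟨0, ?_⟩
      rintro r ⟨x₀, x₁, -, rfl⟩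
      positivity
    · exact ⟨p.fst, p.snd, (key p).1 hp, rfl⟩

/-- The inclusion of `X₀` in `X₀ + X₁`. -/
def inl (x : X₀) : c.Sum := Submodule.Quotient.mk (WithLp.toLp 1 (x, 0))

/-- The inclusion of `X₁` in `X₀ + X₁`. -/
def inr (x : X₁) : c.Sum := Submodule.Quotient.mk (WithLp.toLp 1 (0, x))

theorem norm_inl_le (x : X₀) : ‖c.inl x‖ ≤ ‖x‖ := by
  refine (Submodule.Quotient.norm_mk_le _ _).trans ?_
  simp

theorem norm_inr_le (x : X₁) : ‖c.inr x‖ ≤ ‖x‖ := by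
  refine (Submodule.Quotient.norm_mk_le _ _).trans ?_
  simp

/-! ### The Calderón functions and the complex interpolation spaces -/

/-- `f` is a Calderón function of the couple, with boundary values `g₀` and `g₁`:
`f` is a function with values in `X₀ + X₁` that is continuous and bounded on the closed strip
`0 ≤ Re z ≤ 1` and analytic on the open strip `0 < Re z < 1`; `t ↦ f (it) = g₀ t` is a continuous
function to `X₀` that tends to `0` at infinity, and `t ↦ f (1 + it) = g₁ t` is a continuous function
to `X₁` that tends to `0` at infinity. Values of `f` outside the closed strip are irrelevant. -/
structure IsCalderon (f : ℂ → c.Sum) (g₀ : C₀(ℝ, X₀)) (g₁ : C₀(ℝ, X₁)) : Prop where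
  continuousOn : ContinuousOn f {z : ℂ | 0 ≤ z.re ∧ z.re ≤ 1}
  bounded : ∃ C : ℝ, ∀ z : ℂ, 0 ≤ z.re → z.re ≤ 1 → ‖f z‖ ≤ C
  analytic : DifferentiableOn ℂ f {z : ℂ | 0 < z.re ∧ z.re < 1}
  left : ∀ t : ℝ, f (t * I) = c.inl (g₀ t)
  right : ∀ t : ℝ, f (1 + t * I) = c.inr (g₁ t)

variable {c}

theorem IsCalderon.add {f f' : ℂ → c.Sum} {g₀ g₀' : C₀(ℝ, X₀)} {g₁ g₁' : C₀(ℝ, X₁)}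
    (h : c.IsCalderon f g₀ g₁) (h' : c.IsCalderon f' g₀' g₁') :
    c.IsCalderon (f + f') (g₀ + g₀') (g₁ + g₁') where
  continuousOn := h.continuousOn.add h'.continuousOn
  bounded := by
    obtain ⟨C, hC⟩ := h.bounded
    obtain ⟨C', hC'⟩ := h'.bounded
    exact ⟨C + C', fun z h0 h1 => (norm_add_le _ _).trans (add_le_add (hC z h0 h1) (hC' z h0 h1))⟩
  analytic := h.analytic.add h'.analytic
  left t := by
    rw [Pi.add_apply, h.left, h'.left]
    simp only [inl, ZeroAtInftyContinuousMap.add_apply, ← Submodule.Quotient.mk_add,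
      ← WithLp.toLp_add, Prod.mk_add_mk, add_zero]
  right t := by
    rw [Pi.add_apply, h.right, h'.right]
    simp only [inr, ZeroAtInftyContinuousMap.add_apply, ← Submodule.Quotient.mk_add,
      ← WithLp.toLp_add, Prod.mk_add_mk, add_zero]

theorem IsCalderon.smul {f : ℂ → c.Sum} {g₀ : C₀(ℝ, X₀)} {g₁ : C₀(ℝ, X₁)} (a : ℂ)
    (h : c.IsCalderon f g₀ g₁) : c.IsCalderon (a • f) (a • g₀) (a • g₁) where
  continuousOn := h.continuousOn.const_smul a
  bounded := by
    obtain ⟨C, hC⟩ := h.bounded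
    refine ⟨‖a‖ * C, fun z h0 h1 => ?_⟩
    rw [Pi.smul_apply, norm_smul]
    exact mul_le_mul_of_nonneg_left (hC z h0 h1) (norm_nonneg a)
  analytic := h.analytic.const_smul a
  left t := by
    rw [Pi.smul_apply, h.left]
    simp only [inl, ZeroAtInftyContinuousMap.smul_apply, ← Submodule.Quotient.mk_smul,
      ← WithLp.toLp_smul, Prod.smul_mk, smul_zero]
  right t := by
    rw [Pi.smul_apply, h.right]
    simp only [inr, ZeroAtInftyContinuousMap.smul_apply, ← Submodule.Quotient.mk_smul,
      ← WithLp.toLp_smul, Prod.smul_mk, smul_zero]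

theorem IsCalderon.zero : c.IsCalderon 0 0 0 where
  continuousOn := continuousOn_const
  bounded := ⟨0, fun z _ _ => by simp⟩
  analytic := differentiableOn_const 0
  left t := rfl
  right t := rfl

/-- The maximum principle on the strip. -/
theorem IsCalderon.norm_le {f : ℂ → c.Sum} {g₀ : C₀(ℝ, X₀)} {g₁ : C₀(ℝ, X₁)}
    (h : c.IsCalderon f g₀ g₁) {z : ℂ} (h0 : 0 ≤ z.re) (h1 : z.re ≤ 1) :
    ‖f z‖ ≤ max ‖g₀‖ ‖g₁‖ := by
  have hcl : closure (re ⁻¹' Ioo (0 : ℝ) 1) = {z : ℂ | 0 ≤ z.re ∧ z.re ≤ 1} := by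
    rw [closure_preimage_re, closure_Ioo zero_ne_one]
    rfl
  refine PhragmenLindelof.vertical_strip (a := 0) (b := 1)
    ⟨h.analytic, by rw [hcl]; exact h.continuousOn⟩ ⟨0, by simp [Real.pi_pos], 0, ?_⟩ ?_ ?_ h0 h1
  · obtain ⟨C, hC⟩ := h.bounded
    refine Asymptotics.IsBigO.of_bound C ?_
    filter_upwards [mem_inf_of_right (mem_principal_self _)] with z hz
    simpa using hC z hz.1.le hz.2.le
  · intro z hz
    have : z = (z.im : ℂ) * I := by apply Complex.ext <;> simp [hz]
    rw [this, h.left]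
    exact (c.norm_inl_le _).trans ((g₀.toBCF.norm_coe_le_norm z.im).trans (le_max_left _ _))
  · intro z hz
    have : z = 1 + (z.im : ℂ) * I := by apply Complex.ext <;> simp [hz]
    rw [this, h.right]
    exact (c.norm_inr_le _).trans ((g₁.toBCF.norm_coe_le_norm z.im).trans (le_max_right _ _))

variable (c)

/-- The underlying vector space of `[X₀, X₁]_θ`: all values `f θ` of Calderón functions `f`. -/
def interpSubmodule (θ : Ioo (0 : ℝ) 1) : Submodule ℂ c.Sum where
  carrier := {x | ∃ f g₀ g₁, c.IsCalderon f g₀ g₁ ∧ f ((θ : ℝ) : ℂ) = x}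
  add_mem' := by
    rintro x y ⟨f, g₀, g₁, h, rfl⟩ ⟨f', g₀', g₁', h', rfl⟩
    exact ⟨_, _, _, h.add h', rfl⟩
  zero_mem' := ⟨_, _, _, IsCalderon.zero, rfl⟩
  smul_mem' := by
    rintro a x ⟨f, g₀, g₁, h, rfl⟩
    exact ⟨_, _, _, h.smul a, rfl⟩

/-- The complex interpolation space `[X₀, X₁]_θ` of Calderón. It is a type of its own, since its
norm is not the one of `X₀ + X₁`. -/
def Interp (θ : Ioo (0 : ℝ) 1) : Type (max u v) := c.interpSubmodule θ

variable (θ : Ioo (0 : ℝ) 1)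

noncomputable instance : AddCommGroup (c.Interp θ) :=
  inferInstanceAs (AddCommGroup (c.interpSubmodule θ))

noncomputable instance : Module ℂ (c.Interp θ) :=
  inferInstanceAs (Module ℂ (c.interpSubmodule θ))

/-- The inclusion of `[X₀, X₁]_θ` in `X₀ + X₁`. -/
def Interp.toSum : c.Interp θ →ₗ[ℂ] c.Sum := (c.interpSubmodule θ).subtype

/-- The norms `max (sup_t ‖f (it)‖_{X₀}) (sup_t ‖f (1 + it)‖_{X₁})` of the Calderón functions `f`
that take the value `x` at `θ`. -/
def normSet (x : c.Interp θ) : Set ℝ :=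
  {r : ℝ | ∃ f g₀ g₁, c.IsCalderon f g₀ g₁ ∧ f ((θ : ℝ) : ℂ) = Interp.toSum c θ x ∧
    r = max ‖g₀‖ ‖g₁‖}

/-- The norm of `[X₀, X₁]_θ`. -/
noncomputable instance : Norm (c.Interp θ) where
  norm x := sInf (c.normSet θ x)

theorem normSet_nonempty (x : c.Interp θ) : (c.normSet θ x).Nonempty := by
  obtain ⟨f, g₀, g₁, h, hx⟩ := x.2
  exact ⟨_, f, g₀, g₁, h, hx, rfl⟩

theorem normSet_bddBelow (x : c.Interp θ) : BddBelow (c.normSet θ x) := by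
  refine ⟨0, ?_⟩
  rintro r ⟨f, g₀, g₁, -, -, rfl⟩
  positivity

theorem interp_norm_le {x : c.Interp θ} {f : ℂ → c.Sum} {g₀ : C₀(ℝ, X₀)} {g₁ : C₀(ℝ, X₁)}
    (h : c.IsCalderon f g₀ g₁) (hx : f ((θ : ℝ) : ℂ) = Interp.toSum c θ x) :
    ‖x‖ ≤ max ‖g₀‖ ‖g₁‖ :=
  csInf_le (c.normSet_bddBelow θ x) ⟨f, g₀, g₁, h, hx, rfl⟩

theorem exists_lt_interp_norm_add (x : c.Interp θ) {ε : ℝ} (hε : 0 < ε) :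
    ∃ f g₀ g₁, c.IsCalderon f g₀ g₁ ∧ f ((θ : ℝ) : ℂ) = Interp.toSum c θ x ∧
      max ‖g₀‖ ‖g₁‖ < ‖x‖ + ε := by
  obtain ⟨r, ⟨f, g₀, g₁, h, hx, rfl⟩, hr⟩ :=
    exists_lt_of_csInf_lt (c.normSet_nonempty θ x) (lt_add_of_pos_right (sInf (c.normSet θ x)) hε)
  exact ⟨f, g₀, g₁, h, hx, hr⟩

theorem norm_toSum_le (x : c.Interp θ) : ‖Interp.toSum c θ x‖ ≤ ‖x‖ := by
  refine le_of_forall_pos_le_add fun ε hε => ?_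
  obtain ⟨f, g₀, g₁, h, hx, hlt⟩ := c.exists_lt_interp_norm_add θ x hε
  rw [← hx]
  exact (h.norm_le (by simpa using θ.2.1.le) (by simpa using θ.2.2.le)).trans hlt.le

theorem interp_norm_smul_le (a : ℂ) (x : c.Interp θ) : ‖a • x‖ ≤ ‖a‖ * ‖x‖ := by
  have key : ∀ ε > 0, ‖a • x‖ ≤ ‖a‖ * (‖x‖ + ε) := fun ε hε => by
    obtain ⟨f, g₀, g₁, h, hx, hlt⟩ := c.exists_lt_interp_norm_add θ x hε
    refine (c.interp_norm_le θ (h.smul a) (by rw [Pi.smul_apply, hx, map_smul])).trans ?_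
    rw [norm_smul, norm_smul, ← mul_max_of_nonneg _ _ (norm_nonneg a)]
    exact mul_le_mul_of_nonneg_left hlt.le (norm_nonneg a)
  have hlim : Tendsto (fun ε : ℝ => ‖a‖ * (‖x‖ + ε)) (𝓝[>] 0) (𝓝 (‖a‖ * (‖x‖ + 0))) :=
    Tendsto.mono_left (Continuous.tendsto (by fun_prop) 0) nhdsWithin_le_nhds
  rw [add_zero] at hlim
  exact ge_of_tendsto hlim (eventually_mem_nhdsWithin.mono key)

theorem interp_core : NormedSpace.Core ℂ (c.Interp θ) where
  norm_nonneg x := (norm_nonneg _).trans (c.norm_toSum_le θ x)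
  norm_smul a x := by
    refine le_antisymm (c.interp_norm_smul_le θ a x) ?_
    rcases eq_or_ne a 0 with rfl | ha
    · simpa using (norm_nonneg _).trans (c.norm_toSum_le θ ((0 : ℂ) • x))
    · have := c.interp_norm_smul_le θ a⁻¹ (a • x)
      rw [inv_smul_smul₀ ha, norm_inv] at this
      rwa [← le_inv_mul_iff₀ (norm_pos_iff.2 ha)]
  norm_triangle x y := by
    refine le_of_forall_pos_le_add fun ε hε => ?_
    obtain ⟨f, g₀, g₁, h, hx, hlt⟩ := c.exists_lt_interp_norm_add θ x (half_pos hε)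
    obtain ⟨f', g₀', g₁', h', hy, hlt'⟩ := c.exists_lt_interp_norm_add θ y (half_pos hε)
    refine (c.interp_norm_le θ (h.add h') (by rw [Pi.add_apply, hx, hy, map_add])).trans ?_
    have e0 := norm_add_le g₀ g₀'
    have e1 := norm_add_le g₁ g₁'
    rw [max_lt_iff] at hlt hlt'
    refine max_le ?_ ?_ <;> linarith
  norm_eq_zero_iff x := by
    constructor
    · intro hx
      have h0 : Interp.toSum c θ x = 0 := norm_le_zero_iff.1 ((c.norm_toSum_le θ x).trans hx.le)
      exact Subtype.ext h0
    · rintro rfl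
      refine le_antisymm ?_ ((norm_nonneg _).trans (c.norm_toSum_le θ 0))
      simpa using c.interp_norm_le θ (x := 0) IsCalderon.zero (by simp)

noncomputable instance : NormedAddCommGroup (c.Interp θ) :=
  NormedAddCommGroup.ofCore (c.interp_core θ)

noncomputable instance : NormedSpace ℂ (c.Interp θ) :=
  NormedSpace.ofCore (c.interp_core θ)

end BanachCouple

/-! Write `M f` for the larger of the sup norms of the two boundary values of a Calderón function
`f`, and `ρ` for the modulus at `θ` of the Blaschke factor of the strip with zero `φ`, which is
symmetric in `θ` and `φ`. The link between the two spaces is that one `f` provides both `x = f θ`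
and `y = f φ`.

If `f` vanishes at `φ`, division by the Blaschke factor leaves a Calderón function with no larger
boundary norms, since the factor is unimodular on both edges; hence `‖f θ‖ ≤ ρ * M f` in the space
at `θ` (`IsCalderon.interp_norm_le_of_eq_zero`). Apply this to the difference of `f` and a nearly
optimal representative of `y`, which has boundary norm at most about `2 * M f`: the result is `‖x‖ ≤
‖y‖ + 2 * ρ * M f`, and the same with the roles exchanged (`IsCalderon.interp_norm_le_add`).

Such a two-sided comparison suffices to glue the spaces (`kadetsDist_le_of_relation`): the direct
sum carries a seminorm that restricts to the given norms and makes partners `x`, `y` at cost `t` lie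
within `2 * ρ * t`. Its completion is a common superspace in which the unit balls have Hausdorff
distance at most `2 * ρ`. Continuity follows because `ρ → 0` as `φ → θ`. -/

/-! ### An upper bound for the Kadets distance -/

/-- The Hausdorff completion of a vector space with respect to a seminorm. -/
theorem Seminorm.exists_completion {W : Type u} [AddCommGroup W] [Module ℂ W] (p : Seminorm ℂ W) :
    ∃ (Z : Type u) (_ : NormedAddCommGroup Z) (_ : NormedSpace ℂ Z) (_ : CompleteSpace Z)
      (T : W →ₗ[ℂ] Z), ∀ x, ‖T x‖ = p x := by
  let : SeminormedAddCommGroup W := p.toAddGroupSeminorm.toSeminormedAddCommGroup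
  have hn : ∀ x : W, ‖x‖ = p x := fun _ => rfl
  let : NormedSpace ℂ W := ⟨fun a x => by rw [hn, hn, map_smul_eq_mul]⟩
  exact ⟨UniformSpace.Completion W, inferInstance, inferInstance, inferInstance,
    (UniformSpace.Completion.toComplₗᵢ (𝕜 := ℂ) (E := W)).toLinearMap,
    fun x => ((UniformSpace.Completion.toComplₗᵢ (𝕜 := ℂ) (E := W)).norm_map x).trans (hn x)⟩

/-- Scaling by `(1 + ε)⁻¹` brings `y` into the unit ball and moves it by at most `ε`. This absorbs
the fact that partners are only almost optimal. -/
theorem exists_mem_image_closedBall_dist_le {Y : Type u} {Z : Type v}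
    [NormedAddCommGroup Y] [NormedSpace ℂ Y] [NormedAddCommGroup Z] [NormedSpace ℂ Z]
    (V : Y →ₗᵢ[ℂ] Z) {z : Z} {y : Y} {s ε : ℝ} (hε : 0 < ε) (hy : ‖y‖ ≤ 1 + ε)
    (h : dist z (V y) ≤ s) : ∃ w ∈ V '' Metric.closedBall 0 1, dist z w ≤ s + ε := by
  have h1 : 0 < 1 + ε := by positivity
  refine ⟨_, ⟨(((1 + ε)⁻¹ : ℝ) : ℂ) • y, ?_, rfl⟩,
    (dist_triangle z (V y) _).trans (add_le_add h ?_)⟩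
  · rw [mem_closedBall_zero_iff, norm_smul, Complex.norm_of_nonneg (by positivity),
      inv_mul_le_iff₀ h1]
    simpa using hy
  · rw [V.dist_map, dist_eq_norm]
    have e : y - (((1 + ε)⁻¹ : ℝ) : ℂ) • y = ((1 - (1 + ε)⁻¹ : ℝ) : ℂ) • y := by
      rw [Complex.ofReal_sub, sub_smul, Complex.ofReal_one, one_smul]
    have h2 : 1 - (1 + ε)⁻¹ = ε / (1 + ε) := by field_simp; ring
    rw [e, norm_smul, h2, Complex.norm_of_nonneg (by positivity)]
    calc ε / (1 + ε) * ‖y‖ ≤ ε / (1 + ε) * (1 + ε) := by gcongr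
      _ = ε := by field_simp

theorem kadetsDist_nonneg (X : Type u) (Y : Type v) [NormedAddCommGroup X] [NormedSpace ℂ X]
    [NormedAddCommGroup Y] [NormedSpace ℂ Y] : 0 ≤ kadetsDist X Y := by
  refine Real.sInf_nonneg ?_
  rintro _ ⟨Z, _, _, _, U, V, rfl⟩
  exact Metric.hausdorffDist_nonneg

theorem kadetsDist_le_hausdorffDist {X : Type u} {Y : Type v} [NormedAddCommGroup X]
    [NormedSpace ℂ X] [NormedAddCommGroup Y] [NormedSpace ℂ Y] {Z : Type (max u v)}
    [NormedAddCommGroup Z] [NormedSpace ℂ Z] [CompleteSpace Z] (U : X →ₗᵢ[ℂ] Z) (V : Y →ₗᵢ[ℂ] Z) :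
    kadetsDist X Y ≤
      Metric.hausdorffDist (U '' Metric.closedBall 0 1) (V '' Metric.closedBall 0 1) := by
  refine csInf_le ⟨0, ?_⟩ ⟨Z, _, _, inferInstance, U, V, rfl⟩
  rintro _ ⟨Z', _, _, _, U', V', rfl⟩
  exact Metric.hausdorffDist_nonneg

/-- Let `R x y t` be a homogeneous additive relation ("`x` and `y` correspond to each other at
cost `t`"), under which each vector has partners at a cost close to its norm, and the norms of
partners differ by at most `r` times the cost. Then the Kadets distance is at most `r`. -/
theorem kadetsDist_le_of_relation {X : Type u} {Y : Type v}
    [NormedAddCommGroup X] [NormedSpace ℂ X] [NormedAddCommGroup Y] [NormedSpace ℂ Y]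
    (R : X → Y → ℝ → Prop) {r : ℝ} (hr : 0 ≤ r)
    (zero : R 0 0 0)
    (add : ∀ x y t x' y' t', R x y t → R x' y' t' → R (x + x') (y + y') (t + t'))
    (smul : ∀ (a : ℂ) x y t, R x y t → R (a • x) (a • y) (‖a‖ * t))
    (left_le : ∀ x y t, R x y t → ‖x‖ ≤ t) (right_le : ∀ x y t, R x y t → ‖y‖ ≤ t)
    (left : ∀ x, ∀ ε > 0, ∃ y, ∃ t < ‖x‖ + ε, R x y t)
    (right : ∀ y, ∀ ε > 0, ∃ x, ∃ t < ‖y‖ + ε, R x y t)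
    (left_le_right : ∀ x y t, R x y t → ‖x‖ ≤ ‖y‖ + r * t)
    (right_le_left : ∀ x y t, R x y t → ‖y‖ ≤ ‖x‖ + r * t) :
    kadetsDist X Y ≤ r := by
  -- The infimum of `S p` is the largest seminorm that is at most the given norms on `X` and `Y` and
  -- at most `r * t` on `(x, -y)` for partners at cost `t`. The plus sign in the second coordinate
  -- comes from `-y`.
  let S : X × Y → Set ℝ := fun p => {s | ∃ x y t, R x y t ∧ s = ‖p.1 - x‖ + ‖p.2 + y‖ + r * t}
  have hS : ∀ p, ∀ s ∈ S p, 0 ≤ s := by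
    rintro p s ⟨x, y, t, h, rfl⟩
    have := (norm_nonneg _).trans (left_le x y t h)
    positivity
  have hne : ∀ p, (S p).Nonempty := fun p => ⟨_, 0, 0, 0, zero, rfl⟩
  have hle : ∀ p x y t, R x y t → sInf (S p) ≤ ‖p.1 - x‖ + ‖p.2 + y‖ + r * t :=
    fun p x y t h => csInf_le ⟨0, hS p⟩ ⟨x, y, t, h, rfl⟩
  have hlt : ∀ p, ∀ ε > 0, ∃ x y t, R x y t ∧ ‖p.1 - x‖ + ‖p.2 + y‖ + r * t < sInf (S p) + ε := by
    intro p ε hε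
    obtain ⟨_, ⟨x, y, t, h, rfl⟩, hs⟩ := exists_lt_of_csInf_lt (hne p)
      (lt_add_of_pos_right (sInf (S p)) hε)
    exact ⟨x, y, t, h, hs⟩
  let N : Seminorm ℂ (X × Y) := Seminorm.ofSMulLE (fun p => sInf (S p))
    (le_antisymm ((hle 0 0 0 0 zero).trans_eq (by simp)) (le_csInf (hne 0) (hS 0)))
    (fun p q => by
      refine le_of_forall_pos_le_add fun ε hε => ?_
      obtain ⟨x, y, t, h, hs⟩ := hlt p _ (half_pos hε)
      obtain ⟨x', y', t', h', hs'⟩ := hlt q _ (half_pos hε)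
      refine (hle (p + q) _ _ _ (add _ _ _ _ _ _ h h')).trans ?_
      have e1 : ‖(p + q).1 - (x + x')‖ ≤ ‖p.1 - x‖ + ‖q.1 - x'‖ := by
        rw [Prod.fst_add, add_sub_add_comm]; exact norm_add_le _ _
      have e2 : ‖(p + q).2 + (y + y')‖ ≤ ‖p.2 + y‖ + ‖q.2 + y'‖ := by
        rw [Prod.snd_add, add_add_add_comm]; exact norm_add_le _ _
      linarith)
    (fun a p => by
      refine le_of_forall_pos_le_add fun ε hε => ?_
      -- The tolerance is divided by `‖a‖ + 1` rather than `‖a‖`, to cover `a = 0`.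
      have ha : 0 < ‖a‖ + 1 := by positivity
      obtain ⟨x, y, t, h, hs⟩ := hlt p (ε / (‖a‖ + 1)) (by positivity)
      refine (hle (a • p) _ _ _ (smul a _ _ _ h)).trans ?_
      rw [Prod.smul_fst, Prod.smul_snd, ← smul_sub, ← smul_add, norm_smul, norm_smul]
      have e1 := mul_le_mul_of_nonneg_left hs.le (norm_nonneg a)
      have e2 : ‖a‖ * (ε / (‖a‖ + 1)) ≤ ε := by
        rw [mul_div_assoc', div_le_iff₀ ha]; nlinarith
      linarith)
  have hN : ∀ p, N p = sInf (S p) := fun _ => rfl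
  -- The zero relation gives `≤`. For `≥`, the comparison of norms bounds `‖y'‖ + r * t` below by
  -- `‖x'‖`, and the triangle inequality finishes.
  have hN1 : ∀ x : X, N (x, 0) = ‖x‖ := fun x => by
    rw [hN]
    refine le_antisymm ((hle _ 0 0 0 zero).trans_eq (by simp)) (le_csInf (hne _) ?_)
    rintro s ⟨x', y', t, h, rfl⟩
    have e1 := left_le_right _ _ _ h
    have e2 := norm_add_le (x - x') x'
    rw [sub_add_cancel] at e2
    rw [zero_add]
    linarith
  have hN2 : ∀ y : Y, N (0, y) = ‖y‖ := fun y => by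
    rw [hN]
    refine le_antisymm ((hle _ 0 0 0 zero).trans_eq (by simp)) (le_csInf (hne _) ?_)
    rintro s ⟨x', y', t, h, rfl⟩
    have e1 := right_le_left _ _ _ h
    have e2 := norm_sub_le (y + y') y'
    rw [add_sub_cancel_right] at e2
    rw [zero_sub, norm_neg]
    linarith
  obtain ⟨Z, _, _, _, T, hT⟩ := N.exists_completion
  let U : X →ₗᵢ[ℂ] Z := ⟨T.comp (LinearMap.inl ℂ X Y), fun x => (hT _).trans (hN1 x)⟩
  let V : Y →ₗᵢ[ℂ] Z := ⟨T.comp (LinearMap.inr ℂ X Y), fun y => (hT _).trans (hN2 y)⟩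
  have hUV : ∀ x y t, R x y t → dist (U x) (V y) ≤ r * t := fun x y t h => by
    have e : U x - V y = T (x, -y) := by
      change T (x, 0) - T (0, y) = T (x, -y)
      rw [← map_sub, Prod.mk_sub_mk, sub_zero, zero_sub]
    rw [dist_eq_norm, e, hT, hN]
    exact (hle _ x y t h).trans_eq (by simp)
  have key : ∀ ε > 0, kadetsDist X Y ≤ r * (1 + ε) + ε := fun ε hε => by
    have hmono : ∀ t < 1 + ε, r * t ≤ r * (1 + ε) := fun t ht =>
      mul_le_mul_of_nonneg_left ht.le hr
    refine (kadetsDist_le_hausdorffDist U V).trans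
      (Metric.hausdorffDist_le_of_mem_dist (by positivity) ?_ ?_)
    · rintro _ ⟨x, hx, rfl⟩
      rw [mem_closedBall_zero_iff] at hx
      obtain ⟨y, t, ht, h⟩ := left x ε hε
      have ht' : t < 1 + ε := by linarith
      exact exists_mem_image_closedBall_dist_le V hε ((right_le _ _ _ h).trans ht'.le)
        ((hUV _ _ _ h).trans (hmono t ht'))
    · rintro _ ⟨y, hy, rfl⟩
      rw [mem_closedBall_zero_iff] at hy
      obtain ⟨x, t, ht, h⟩ := right y ε hε
      have ht' : t < 1 + ε := by linarith
      refine exists_mem_image_closedBall_dist_le U hε ((left_le _ _ _ h).trans ht'.le) ?_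
      rw [dist_comm]
      exact (hUV _ _ _ h).trans (hmono t ht')
  refine le_of_forall_pos_le_add fun δ hδ => ?_
  have h1 : 0 < r + 1 := by positivity
  refine (key (δ / (r + 1)) (by positivity)).trans_eq ?_
  field_simp
  ring

/-! ### Division of a Calderón function by a Blaschke factor of the strip -/

theorem Complex.norm_sin_le_cosh (w : ℂ) : ‖Complex.sin w‖ ≤ Real.cosh w.im := by
  have h : ‖2 * Complex.sin w‖ ≤ Real.exp w.im + Real.exp (-w.im) := by
    rw [Complex.two_sin, norm_mul, Complex.norm_I, mul_one]
    refine (norm_sub_le _ _).trans_eq ?_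
    simp [Complex.norm_exp]
  rw [norm_mul, Complex.norm_two] at h
  rw [Real.cosh_eq]
  linarith

theorem Complex.abs_sinh_le_norm_sin (w : ℂ) : |Real.sinh w.im| ≤ ‖Complex.sin w‖ := by
  have h : |Real.exp w.im - Real.exp (-w.im)| ≤ ‖2 * Complex.sin w‖ := by
    rw [Complex.two_sin, norm_mul, Complex.norm_I, mul_one]
    refine le_trans (le_of_eq ?_) (abs_norm_sub_norm_le _ _)
    simp [Complex.norm_exp]
  rw [norm_mul, Complex.norm_two] at h
  rw [Real.sinh_eq, abs_div, abs_two]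
  linarith

/-- The modulus of sine lies between `|sinh|` and `cosh` of the imaginary part, and `cosh ^ 2 = sinh
^ 2 + 1 ≤ 4 * sinh ^ 2` once `|sinh| ≥ 1`. It bounds the inverse Blaschke factor far from the real
axis. -/
theorem Complex.norm_sin_le_two_mul_norm_sin {w w' : ℂ} (h : w.im = w'.im) (h1 : 1 ≤ |w'.im|) :
    ‖Complex.sin w‖ ≤ 2 * ‖Complex.sin w'‖ := by
  refine (Complex.norm_sin_le_cosh w).trans (le_trans ?_
    (mul_le_mul_of_nonneg_left (Complex.abs_sinh_le_norm_sin w') zero_le_two))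
  rw [h]
  have e1 : 1 ≤ |Real.sinh w'.im| := by
    rw [Real.abs_sinh]
    exact h1.trans (Real.self_le_sinh_iff.2 (abs_nonneg _))
  have e2 := Real.cosh_sq w'.im
  have e3 := sq_abs (Real.sinh w'.im)
  have e4 := Real.cosh_pos w'.im
  nlinarith

/-- The function `z ↦ sin (π (z + φ) / 2)`. For `0 < φ < 1` the quotient `stripSin (-φ) / stripSin φ`
is the Blaschke factor with zero `φ` of the strip `0 < Re z < 1`. -/
noncomputable def stripSin (φ : ℝ) (z : ℂ) : ℂ := Complex.sin (Real.pi * (z + φ) / 2)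

theorem differentiable_stripSin (φ : ℝ) : Differentiable ℂ (stripSin φ) := by
  unfold stripSin
  fun_prop

theorem stripSin_ofReal (φ θ : ℝ) :
    stripSin φ θ = ((Real.sin (Real.pi * (θ + φ) / 2) : ℝ) : ℂ) := by
  simp [stripSin]

theorem stripSin_neg_self (φ : ℝ) : stripSin (-φ) φ = 0 := by
  simp [stripSin]

/-- The zeros are `φ + 2 * k` with `k` an integer, and only `k = 0` lands in the closed strip. -/
theorem stripSin_ne_zero {φ : ℝ} (hφ : φ ∈ Ioo (0 : ℝ) 1) {z : ℂ} (h0 : 0 ≤ z.re) (h1 : z.re ≤ 1)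
    (hz : z ≠ φ) : stripSin (-φ) z ≠ 0 := by
  intro h
  obtain ⟨k, hk⟩ := Complex.sin_eq_zero_iff.1 h
  have hpi : (Real.pi : ℂ) ≠ 0 := Complex.ofReal_ne_zero.2 Real.pi_ne_zero
  have e : z - φ = 2 * k := by
    have : (Real.pi : ℂ) * (z - φ - 2 * k) = 0 := by
      push_cast at hk
      linear_combination 2 * hk
    exact sub_eq_zero.1 ((mul_eq_zero.1 this).resolve_left hpi)
  have e' : z.re - φ = 2 * (k : ℝ) := by
    have := congrArg Complex.re e
    simpa using this
  have hk1 : (k : ℝ) < 1 := by linarith [hφ.1]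
  have hk2 : (-1 : ℝ) < k := by linarith [hφ.2]
  have hk0 : k = 0 := by
    have a1 : k < 1 := by exact_mod_cast hk1
    have a2 : -1 < k := by exact_mod_cast hk2
    omega
  rw [hk0] at e
  exact hz (sub_eq_zero.1 (by simpa using e))

theorem deriv_stripSin_neg (φ : ℝ) : deriv (stripSin (-φ)) φ = Real.pi / 2 := by
  have h : HasDerivAt (fun z : ℂ => (Real.pi : ℂ) * (z + ((-φ : ℝ) : ℂ)) / 2)
      (Real.pi * 1 / 2) (φ : ℂ) :=
    (((hasDerivAt_id (φ : ℂ)).add_const _).const_mul _).div_const _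
  have h' : HasDerivAt (stripSin (-φ)) _ φ := h.csin
  rw [h'.deriv]
  simp

/-- The zero at `φ` is simple, with derivative `π / 2`, so the divided difference has no zero left
in the closed strip. -/
theorem dslope_stripSin_ne_zero {φ : ℝ} (hφ : φ ∈ Ioo (0 : ℝ) 1) {z : ℂ} (h0 : 0 ≤ z.re)
    (h1 : z.re ≤ 1) : dslope (stripSin (-φ)) φ z ≠ 0 := by
  rcases eq_or_ne z φ with rfl | hz
  · rw [dslope_same, deriv_stripSin_neg]
    simp [Real.pi_ne_zero]
  · intro h
    have e := sub_smul_dslope (stripSin (-φ)) (φ : ℂ) z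
    rw [h, stripSin_neg_self, smul_zero, sub_zero] at e
    exact stripSin_ne_zero hφ h0 h1 hz e.symm

/-- The points `it + φ` and `it - φ` are mirror images in the imaginary axis. Hence the Blaschke
factor is unimodular on the left edge. -/
theorem norm_stripSin_left (φ t : ℝ) : ‖stripSin φ (t * I)‖ = ‖stripSin (-φ) (t * I)‖ := by
  have : stripSin φ (t * I) = -(starRingEnd ℂ) (stripSin (-φ) (t * I)) := by
    unfold stripSin
    rw [← Complex.sin_conj, ← Complex.sin_neg]
    congr 1
    simp [Complex.conj_ofNat]
    ring
  rw [this, norm_neg, RCLike.norm_conj]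

/-- Here the reflection is in the line `Re z = 1`, combined with `sin (π - w) = sin w`. -/
theorem norm_stripSin_right (φ t : ℝ) :
    ‖stripSin φ (1 + t * I)‖ = ‖stripSin (-φ) (1 + t * I)‖ := by
  have : stripSin φ (1 + t * I) = (starRingEnd ℂ) (stripSin (-φ) (1 + t * I)) := by
    unfold stripSin
    rw [← Complex.sin_conj, ← Complex.sin_pi_sub]
    congr 1
    simp [Complex.conj_ofNat]
    ring
  rw [this, RCLike.norm_conj]

/-- Multiplication of a function vanishing at infinity by a continuous unimodular function. -/
theorem ZeroAtInftyContinuousMap.exists_unimodular_smul {E : Type u} [NormedAddCommGroup E]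
    [NormedSpace ℂ E] (g : C₀(ℝ, E)) {a : ℝ → ℂ} (ha : Continuous a) (h1 : ∀ t, ‖a t‖ = 1) :
    ∃ g' : C₀(ℝ, E), (∀ t, g' t = a t • g t) ∧ ‖g'‖ ≤ ‖g‖ := by
  have hn : ∀ t, ‖a t • g t‖ = ‖g t‖ := fun t => by rw [norm_smul, h1, one_mul]
  let g' : C₀(ℝ, E) := ⟨⟨fun t => a t • g t, ha.smul g.continuous⟩, by
    have := zero_at_infty g
    rw [tendsto_zero_iff_norm_tendsto_zero] at this ⊢
    exact this.congr fun t => (hn t).symm⟩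
  refine ⟨g', fun t => rfl, ?_⟩
  rw [← ZeroAtInftyContinuousMap.norm_toBCF_eq_norm, ← ZeroAtInftyContinuousMap.norm_toBCF_eq_norm,
    BoundedContinuousFunction.norm_le (norm_nonneg _)]
  exact fun t => (hn t).trans_le (g.toBCF.norm_coe_le_norm t)

namespace BanachCouple

variable {X₀ : Type u} {X₁ : Type v} {V : Type w}
  [NormedAddCommGroup X₀] [NormedSpace ℂ X₀] [CompleteSpace X₀]
  [NormedAddCommGroup X₁] [NormedSpace ℂ X₁] [CompleteSpace X₁]
  [AddCommGroup V] [Module ℂ V] [TopologicalSpace V] [IsTopologicalAddGroup V]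
  [ContinuousSMul ℂ V] [T2Space V] (c : BanachCouple X₀ X₁ V)

theorem inl_smul (a : ℂ) (x : X₀) : c.inl (a • x) = a • c.inl x := by
  simp only [inl, ← Submodule.Quotient.mk_smul, ← WithLp.toLp_smul, Prod.smul_mk, smul_zero]

theorem inr_smul (a : ℂ) (x : X₁) : c.inr (a • x) = a • c.inr x := by
  simp only [inr, ← Submodule.Quotient.mk_smul, ← WithLp.toLp_smul, Prod.smul_mk, smul_zero]

variable {c}

/-- A Calderón function that vanishes at `φ` is divisible by the Blaschke factor with zero `φ`. -/
theorem IsCalderon.exists_blaschke_quotient {f : ℂ → c.Sum} {g₀ : C₀(ℝ, X₀)} {g₁ : C₀(ℝ, X₁)}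
    (h : c.IsCalderon f g₀ g₁) {φ : ℝ} (hφ : φ ∈ Ioo (0 : ℝ) 1) (hf : f φ = 0) :
    ∃ k k₀ k₁, c.IsCalderon k k₀ k₁ ∧ ‖k₀‖ ≤ ‖g₀‖ ∧ ‖k₁‖ ≤ ‖g₁‖ ∧
      ∀ z : ℂ, 0 ≤ z.re → z.re ≤ 1 → stripSin (-φ) z • k z = stripSin φ z • f z := by
  have hd := differentiable_stripSin (-φ)
  have hopen : IsOpen {z : ℂ | 0 < z.re ∧ z.re < 1} :=
    (isOpen_lt continuous_const Complex.continuous_re).inter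
      (isOpen_lt Complex.continuous_re continuous_const)
  have hmem : {z : ℂ | 0 < z.re ∧ z.re < 1} ∈ 𝓝 (φ : ℂ) := hopen.mem_nhds (by simpa using hφ)
  have hmem' : {z : ℂ | 0 ≤ z.re ∧ z.re ≤ 1} ∈ 𝓝 (φ : ℂ) :=
    mem_of_superset hmem fun z hz => ⟨hz.1.le, hz.2.le⟩
  have hdd : Differentiable ℂ (dslope (stripSin (-φ)) φ) :=
    differentiableOn_univ.1 ((Complex.differentiableOn_dslope univ_mem).2 hd.differentiableOn)
  -- The factor `z - φ` is cancelled from both `f` and `stripSin (-φ)` by divided differences, so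
  -- the quotient is defined and regular at `φ` as well.
  let q : ℂ → ℂ := fun z => stripSin φ z * (dslope (stripSin (-φ)) φ z)⁻¹
  let k : ℂ → c.Sum := fun z => q z • dslope f φ z
  have hk : ∀ z : ℂ, 0 ≤ z.re → z.re ≤ 1 → stripSin (-φ) z • k z = stripSin φ z • f z := by
    intro z h0 h1
    have e1 := sub_smul_dslope (stripSin (-φ)) (φ : ℂ) z
    have e2 := sub_smul_dslope f (φ : ℂ) z
    rw [stripSin_neg_self, sub_zero, smul_eq_mul] at e1
    rw [hf, sub_zero] at e2
    have hne := dslope_stripSin_ne_zero hφ h0 h1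
    simp only [k, q]
    rw [← e1, ← e2, smul_smul, smul_smul]
    congr 1
    field_simp
  have hqc : ContinuousOn q {z : ℂ | 0 ≤ z.re ∧ z.re ≤ 1} :=
    (differentiable_stripSin φ).continuous.continuousOn.mul
      (hdd.continuous.continuousOn.inv₀ fun z hz => dslope_stripSin_ne_zero hφ hz.1 hz.2)
  have hkc : ContinuousOn k {z : ℂ | 0 ≤ z.re ∧ z.re ≤ 1} :=
    hqc.smul ((continuousOn_dslope hmem').2
      ⟨h.continuousOn, h.analytic.differentiableAt hmem⟩)
  have hbd : ∀ z : ℂ, z.re = 0 ∨ z.re = 1 → 0 ≤ z.re ∧ z.re ≤ 1 ∧ stripSin (-φ) z ≠ 0 := by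
    intro z hz
    have h0 : 0 ≤ z.re := by rcases hz with hz | hz <;> simp [hz]
    have h1 : z.re ≤ 1 := by rcases hz with hz | hz <;> simp [hz]
    refine ⟨h0, h1, stripSin_ne_zero hφ h0 h1 ?_⟩
    rintro rfl
    rcases hz with hz | hz
    · exact hφ.1.ne' hz
    · exact hφ.2.ne hz
  have hkb : ∀ z : ℂ, z.re = 0 ∨ z.re = 1 → k z = (stripSin φ z / stripSin (-φ) z) • f z := by
    intro z hz
    obtain ⟨h0, h1, hne⟩ := hbd z hz
    rw [div_eq_inv_mul, mul_smul, ← hk z h0 h1, inv_smul_smul₀ hne]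
  have hl : ∀ t : ℝ, ((t : ℂ) * I).re = 0 := fun t => by simp
  have hr : ∀ t : ℝ, (1 + (t : ℂ) * I).re = 1 := fun t => by simp
  obtain ⟨k₀, hk₀, hn₀⟩ := g₀.exists_unimodular_smul
    (a := fun t : ℝ => stripSin φ (t * I) / stripSin (-φ) (t * I))
    (((differentiable_stripSin φ).continuous.comp (by fun_prop)).div
      (hd.continuous.comp (by fun_prop)) fun t => (hbd _ (Or.inl (hl t))).2.2)
    (fun t => by
      rw [norm_div, norm_stripSin_left, div_self (norm_ne_zero_iff.2 (hbd _ (Or.inl (hl t))).2.2)])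
  obtain ⟨k₁, hk₁, hn₁⟩ := g₁.exists_unimodular_smul
    (a := fun t : ℝ => stripSin φ (1 + t * I) / stripSin (-φ) (1 + t * I))
    (((differentiable_stripSin φ).continuous.comp (by fun_prop)).div
      (hd.continuous.comp (by fun_prop)) fun t => (hbd _ (Or.inr (hr t))).2.2)
    (fun t => by
      rw [norm_div, norm_stripSin_right, div_self (norm_ne_zero_iff.2 (hbd _ (Or.inr (hr t))).2.2)])
  refine ⟨k, k₀, k₁, ⟨hkc, ?_, ?_, ?_, ?_⟩, hn₀, hn₁, hk⟩
  · obtain ⟨C, hC⟩ := h.bounded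
    -- Near the zero `φ` boundedness comes from compactness; for `|Im z| > 1` it comes from the
    -- bound `2` on the inverse Blaschke factor.
    have hK : IsCompact (Icc (0 : ℝ) 1 ×ℂ Icc (-1 : ℝ) 1) := isCompact_Icc.reProdIm isCompact_Icc
    obtain ⟨C', hC'⟩ := hK.exists_bound_of_continuousOn (hkc.mono fun z hz => hz.1)
    refine ⟨max C' (2 * C), fun z h0 h1 => ?_⟩
    by_cases him : |z.im| ≤ 1
    · exact (hC' z ⟨⟨h0, h1⟩, abs_le.1 him⟩).trans (le_max_left _ _)
    · refine le_trans ?_ (le_max_right _ _)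
      have him' : 1 < |z.im| := not_le.1 him
      have e := congrArg norm (hk z h0 h1)
      rw [norm_smul, norm_smul (stripSin φ z) (f z)] at e
      have him2 : ∀ a : ℝ, ((Real.pi : ℂ) * (z + a) / 2).im = Real.pi / 2 * z.im := fun a => by
        have : (Real.pi : ℂ) * (z + a) / 2 = ((Real.pi / 2 : ℝ) : ℂ) * (z + a) := by
          push_cast; ring
        rw [this, Complex.im_ofReal_mul]
        simp
      -- Both sine arguments have imaginary part `π / 2 * Im z`, of modulus above `1` since `π > 3`.
      have hsin : ‖stripSin φ z‖ ≤ 2 * ‖stripSin (-φ) z‖ := by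
        refine Complex.norm_sin_le_two_mul_norm_sin ((him2 _).trans (him2 _).symm) ?_
        rw [him2, abs_mul, abs_of_pos (by positivity)]
        have := Real.pi_gt_three
        nlinarith
      have hpos : 0 < ‖stripSin (-φ) z‖ := norm_pos_iff.2 (stripSin_ne_zero hφ h0 h1 (by
        rintro rfl
        simp at him'
        linarith))
      refine le_of_mul_le_mul_left ?_ hpos
      rw [e]
      calc ‖stripSin φ z‖ * ‖f z‖ ≤ 2 * ‖stripSin (-φ) z‖ * C :=
            mul_le_mul hsin (hC z h0 h1) (norm_nonneg _) (by positivity)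
        _ = _ := by ring
  · exact (((differentiable_stripSin φ).differentiableOn.mul
      (hdd.differentiableOn.inv fun z hz => dslope_stripSin_ne_zero hφ hz.1.le hz.2.le))).smul
      ((Complex.differentiableOn_dslope hmem).2 h.analytic)
  · intro t
    rw [hkb _ (Or.inl (hl t)), h.left, hk₀, inl_smul]
  · intro t
    rw [hkb _ (Or.inr (hr t)), h.right, hk₁, inr_smul]

/-! ### Schwarz lemma and comparison of the norms at two points -/

theorem IsCalderon.sub {f f' : ℂ → c.Sum} {g₀ g₀' : C₀(ℝ, X₀)} {g₁ g₁' : C₀(ℝ, X₁)}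
    (h : c.IsCalderon f g₀ g₁) (h' : c.IsCalderon f' g₀' g₁') :
    c.IsCalderon (f - f') (g₀ - g₀') (g₁ - g₁') := by
  have := h.add (h'.smul (-1))
  simpa only [neg_one_smul, ← sub_eq_add_neg] using this

/-- The modulus at `θ` of the Blaschke factor of the strip with zero `φ`. -/
noncomputable def pseudoDist (θ φ : ℝ) : ℝ :=
  |Real.sin (Real.pi * (φ - θ) / 2)| / Real.sin (Real.pi * (φ + θ) / 2)

theorem sin_pi_mul_add_pos {θ φ : ℝ} (hθ : θ ∈ Ioo (0 : ℝ) 1) (hφ : φ ∈ Ioo (0 : ℝ) 1) :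
    0 < Real.sin (Real.pi * (φ + θ) / 2) := by
  have := Real.pi_pos
  apply Real.sin_pos_of_pos_of_lt_pi
  · have := hθ.1
    have := hφ.1
    positivity
  · nlinarith [hθ.2, hφ.2]

theorem pseudoDist_nonneg (θ φ : Ioo (0 : ℝ) 1) : 0 ≤ pseudoDist θ φ :=
  div_nonneg (abs_nonneg _) (sin_pi_mul_add_pos θ.2 φ.2).le

theorem pseudoDist_comm (θ φ : ℝ) : pseudoDist θ φ = pseudoDist φ θ := by
  unfold pseudoDist
  rw [add_comm φ θ, ← abs_neg (Real.sin (Real.pi * (φ - θ) / 2)), ← Real.sin_neg]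
  congr 3
  ring

/-- A Schwarz lemma: the norm at `θ` of a Calderón function that vanishes at `φ`. -/
theorem IsCalderon.interp_norm_le_of_eq_zero {f : ℂ → c.Sum} {g₀ : C₀(ℝ, X₀)} {g₁ : C₀(ℝ, X₁)}
    (h : c.IsCalderon f g₀ g₁) (θ φ : Ioo (0 : ℝ) 1) (hf : f (φ : ℝ) = 0) {x : c.Interp θ}
    (hx : f (θ : ℝ) = Interp.toSum c θ x) : ‖x‖ ≤ pseudoDist θ φ * max ‖g₀‖ ‖g₁‖ := by
  obtain ⟨k, k₀, k₁, hk, hn₀, hn₁, hq⟩ := h.exists_blaschke_quotient φ.2 hf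
  have e := hq ((θ : ℝ) : ℂ) (by simpa using θ.2.1.le) (by simpa using θ.2.2.le)
  rw [hx] at e
  have hpos := sin_pi_mul_add_pos θ.2 φ.2
  have hs : stripSin φ (θ : ℝ) ≠ 0 := by
    rw [stripSin_ofReal, add_comm]
    exact Complex.ofReal_ne_zero.2 hpos.ne'
  -- This is the value at `θ` of the Blaschke factor, taken as a constant: `b • k` agrees with `f`
  -- at `θ`, and its boundary norms carry the factor `‖b‖`.
  set b : ℂ := (stripSin φ (θ : ℝ))⁻¹ * stripSin (-φ) (θ : ℝ) with hb
  have hbn : ‖b‖ = pseudoDist θ φ := by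
    rw [hb, stripSin_ofReal, stripSin_ofReal, norm_mul, norm_inv, Complex.norm_real,
      Complex.norm_real, pseudoDist_comm, pseudoDist, Real.norm_eq_abs, Real.norm_eq_abs,
      ← sub_eq_add_neg, inv_mul_eq_div, abs_of_pos (a := Real.sin (Real.pi * ((θ : ℝ) + φ) / 2))
        (by rwa [add_comm (θ : ℝ)])]
  have hbk := hk.smul b
  refine (c.interp_norm_le θ hbk ?_).trans ?_
  · rw [Pi.smul_apply, hb, mul_smul, e, inv_smul_smul₀ hs]
  · rw [norm_smul, norm_smul, ← mul_max_of_nonneg _ _ (norm_nonneg b), hbn]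
    exact mul_le_mul_of_nonneg_left (max_le_max hn₀ hn₁) (pseudoDist_nonneg θ φ)

/-- Take a nearly optimal `f'` for `y`. Its value at `θ` has norm close to at most `‖y‖`, and the
Schwarz lemma controls `f - f'`, which vanishes at `φ`. The `2` arises because `‖y‖` is itself at
most the boundary norm of `f`. -/
theorem IsCalderon.interp_norm_le_add {f : ℂ → c.Sum} {g₀ : C₀(ℝ, X₀)} {g₁ : C₀(ℝ, X₁)}
    (h : c.IsCalderon f g₀ g₁) (θ φ : Ioo (0 : ℝ) 1) {x : c.Interp θ} {y : c.Interp φ}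
    (hx : f (θ : ℝ) = Interp.toSum c θ x) (hy : f (φ : ℝ) = Interp.toSum c φ y) :
    ‖x‖ ≤ ‖y‖ + 2 * pseudoDist θ φ * max ‖g₀‖ ‖g₁‖ := by
  have hρ := pseudoDist_nonneg θ φ
  have hyn := c.interp_norm_le φ h hy
  have key : ∀ ε > 0, ‖x‖ ≤ ‖y‖ + ε + pseudoDist θ φ * (2 * max ‖g₀‖ ‖g₁‖ + ε) := by
    intro ε hε
    obtain ⟨f', g₀', g₁', h', hy', hlt⟩ := c.exists_lt_interp_norm_add φ y hε
    let x' : c.Interp θ := ⟨f' (θ : ℝ), f', g₀', g₁', h', rfl⟩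
    have hx' : f' (θ : ℝ) = Interp.toSum c θ x' := rfl
    have e1 := c.interp_norm_le θ h' hx'
    have e2 := (h.sub h').interp_norm_le_of_eq_zero θ φ (x := x - x')
      (by rw [Pi.sub_apply, hy, hy', sub_self]) (by rw [Pi.sub_apply, hx, hx', map_sub])
    have e3 : max ‖g₀ - g₀'‖ ‖g₁ - g₁'‖ ≤ 2 * max ‖g₀‖ ‖g₁‖ + ε := by
      have a0 := norm_sub_le g₀ g₀'
      have a1 := norm_sub_le g₁ g₁'
      have b0 := le_max_left ‖g₀‖ ‖g₁‖
      have b1 := le_max_right ‖g₀‖ ‖g₁‖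
      rw [max_lt_iff] at hlt
      refine max_le ?_ ?_ <;> linarith
    have e4 := mul_le_mul_of_nonneg_left e3 hρ
    have e5 := norm_add_le (x - x') x'
    rw [sub_add_cancel] at e5
    linarith
  refine le_of_forall_pos_le_add fun δ hδ => ?_
  have h1 : 0 < 1 + pseudoDist θ φ := by positivity
  refine (key (δ / (1 + pseudoDist θ φ)) (by positivity)).trans_eq ?_
  field_simp
  ring

end BanachCouple

/-! ### The Kadets distance between interpolation spaces -/

namespace BanachCouple

variable {X₀ : Type u} {X₁ : Type v} {V : Type w}
  [NormedAddCommGroup X₀] [NormedSpace ℂ X₀] [CompleteSpace X₀]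
  [NormedAddCommGroup X₁] [NormedSpace ℂ X₁] [CompleteSpace X₁]
  [AddCommGroup V] [Module ℂ V] [TopologicalSpace V] [IsTopologicalAddGroup V]
  [ContinuousSMul ℂ V] [T2Space V] (c : BanachCouple X₀ X₁ V)

theorem kadetsDist_interp_le (θ φ : Ioo (0 : ℝ) 1) :
    kadetsDist (c.Interp θ) (c.Interp φ) ≤ 2 * pseudoDist θ φ := by
  -- Partners are the values of one Calderón function. The cost is any upper bound for its boundary
  -- norm, so that costs add exactly.
  refine kadetsDist_le_of_relation (fun x y t => ∃ f g₀ g₁, c.IsCalderon f g₀ g₁ ∧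
    f (θ : ℝ) = Interp.toSum c θ x ∧ f (φ : ℝ) = Interp.toSum c φ y ∧ max ‖g₀‖ ‖g₁‖ ≤ t)
    (mul_nonneg zero_le_two (pseudoDist_nonneg θ φ)) ?_ ?_ ?_ ?_ ?_ ?_ ?_ ?_ ?_
  · exact ⟨0, 0, 0, IsCalderon.zero, by simp, by simp, by simp⟩
  · rintro x y t x' y' t' ⟨f, g₀, g₁, h, hx, hy, ht⟩ ⟨f', g₀', g₁', h', hx', hy', ht'⟩
    refine ⟨_, _, _, h.add h', by rw [Pi.add_apply, hx, hx', map_add],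
      by rw [Pi.add_apply, hy, hy', map_add], ?_⟩
    have e0 := norm_add_le g₀ g₀'
    have e1 := norm_add_le g₁ g₁'
    rw [max_le_iff] at ht ht'
    refine max_le ?_ ?_ <;> linarith
  · rintro a x y t ⟨f, g₀, g₁, h, hx, hy, ht⟩
    refine ⟨_, _, _, h.smul a, by rw [Pi.smul_apply, hx, map_smul],
      by rw [Pi.smul_apply, hy, map_smul], ?_⟩
    rw [norm_smul, norm_smul, ← mul_max_of_nonneg _ _ (norm_nonneg a)]
    exact mul_le_mul_of_nonneg_left ht (norm_nonneg a)
  · rintro x y t ⟨f, g₀, g₁, h, hx, hy, ht⟩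
    exact (c.interp_norm_le θ h hx).trans ht
  · rintro x y t ⟨f, g₀, g₁, h, hx, hy, ht⟩
    exact (c.interp_norm_le φ h hy).trans ht
  · intro x ε hε
    obtain ⟨f, g₀, g₁, h, hx, hlt⟩ := c.exists_lt_interp_norm_add θ x hε
    exact ⟨⟨f (φ : ℝ), f, g₀, g₁, h, rfl⟩, _, hlt, f, g₀, g₁, h, hx, rfl, le_rfl⟩
  · intro y ε hε
    obtain ⟨f, g₀, g₁, h, hy, hlt⟩ := c.exists_lt_interp_norm_add φ y hε
    exact ⟨⟨f (θ : ℝ), f, g₀, g₁, h, rfl⟩, _, hlt, f, g₀, g₁, h, rfl, hy, le_rfl⟩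
  · rintro x y t ⟨f, g₀, g₁, h, hx, hy, ht⟩
    exact (h.interp_norm_le_add θ φ hx hy).trans (add_le_add_right (mul_le_mul_of_nonneg_left ht
      (mul_nonneg zero_le_two (pseudoDist_nonneg θ φ))) _)
  · rintro x y t ⟨f, g₀, g₁, h, hx, hy, ht⟩
    rw [pseudoDist_comm]
    exact (h.interp_norm_le_add φ θ hy hx).trans (add_le_add_right (mul_le_mul_of_nonneg_left ht
      (mul_nonneg zero_le_two (pseudoDist_nonneg φ θ))) _)

theorem tendsto_pseudoDist (θ : Ioo (0 : ℝ) 1) :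
    Tendsto (fun φ : Ioo (0 : ℝ) 1 => pseudoDist θ φ) (𝓝 θ) (𝓝 0) := by
  have hc : ContinuousAt (fun φ : Ioo (0 : ℝ) 1 => pseudoDist θ φ) θ :=
    ContinuousAt.div (by fun_prop) (by fun_prop) (sin_pi_mul_add_pos θ.2 θ.2).ne'
  simpa [pseudoDist] using hc.tendsto

end BanachCouple

theorem corollary4p6 {X₀ : Type u} {X₁ : Type v} {V : Type w}
    [NormedAddCommGroup X₀] [NormedSpace ℂ X₀] [CompleteSpace X₀]
    [NormedAddCommGroup X₁] [NormedSpace ℂ X₁] [CompleteSpace X₁]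
    [AddCommGroup V] [Module ℂ V] [TopologicalSpace V] [IsTopologicalAddGroup V]
    [ContinuousSMul ℂ V] [T2Space V] (c : BanachCouple X₀ X₁ V) :
    (∀ θ φ : Set.Ioo (0 : ℝ) 1, θ < φ →
      kadetsDist (c.Interp θ) (c.Interp φ) ≤
        2 * (Real.sin (Real.pi * ((φ : ℝ) - θ) / 2) / Real.sin (Real.pi * ((φ : ℝ) + θ) / 2))) ∧
    (∀ θ : Set.Ioo (0 : ℝ) 1,
      Filter.Tendsto (fun φ : Set.Ioo (0 : ℝ) 1 => kadetsDist (c.Interp θ) (c.Interp φ))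
        (nhds θ) (nhds 0)) := by
  refine ⟨fun θ φ h => ?_, fun θ => ?_⟩
  · refine (c.kadetsDist_interp_le θ φ).trans_eq ?_
    have hpi := Real.pi_pos
    have h' : (θ : ℝ) < φ := h
    rw [BanachCouple.pseudoDist, abs_of_nonneg]
    apply Real.sin_nonneg_of_nonneg_of_le_pi
    · have := sub_pos.2 h'
      positivity
    · nlinarith [θ.2.1, φ.2.2]
  · refine squeeze_zero (fun φ => kadetsDist_nonneg _ _) (fun φ => c.kadetsDist_interp_le θ φ) ?_
    simpa using (BanachCouple.tendsto_pseudoDist θ).const_mul 2
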